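/- Call a metric space $N$ \emph{indivisible} if for every partition of $N$ into two parts, one of the parts contains an isometric copy of $N$; call it \emph{hereditarily indivisible} if $N$ is indivisible and every ball of $N$ (with the induced metric) is indivisible, where a ball is an open ball of positive radius or a closed ball of nonnegative radius. The spectrum of a point $a\in N$ is $\mathrm{Spec}(N,a)=\{d(a,x):x\in N\}$, and the spectrum of $N$ is $\mathrm{Spec}(N)=\{d(x,y):x,y\in N\}$. Call $N$ \emph{spec-endogeneous} if every isometry $f$ from a finite subspace $A\subseteq N$ onto a subspace of $N$ satisfying $\mathrm{Spec}(N,x)\subseteq\mathrm{Spec}(N,f(x))$ for all $x\in A$ extends to an isometric embedding (not necessarily surjective) of $N$ into $N$. \textbf{Theorem.} Let $M$ be a countable (finite or infinite) ultrametric space. Then $M$ embeds isometrically into a countable indivisible ultrametric space if and only if there is no infinite strictly increasing sequence $B_0\subsetneq B_1\subsetneq B_2\subsetneq\cdots$ of balls of $M$. Furthermore, when this condition holds, $M$ embeds isometrically into a countable ultrametric space $N$ which is spec-endogeneous and hereditarily indivisible (in particular indivisible) and satisfies $\mathrm{Spec}(N)=\mathrm{Spec}(M)$. -/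

import Mathlib

universe u

/-- The spectrum of a point `a` of a metric space: the set of distances from `a`. -/
def pointDistSpec {M : Type*} [MetricSpace M] (a : M) : Set ℝ :=
  {r | ∃ x : M, dist a x = r}

/-- The spectrum of a metric space: the set of all distances between its points. -/
def distSpec (M : Type*) [MetricSpace M] : Set ℝ :=
  {r | ∃ x y : M, dist x y = r}

/-- A ball is an open ball of positive radius or a closed ball of nonnegative radius. -/
def IsBallSet {M : Type*} [MetricSpace M] (B : Set M) : Prop :=
  ∃ (a : M) (r : ℝ), (0 < r ∧ B = Metric.ball a r) ∨ (0 ≤ r ∧ B = Metric.closedBall a r)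

/-- The metric space contains an infinite strictly increasing sequence of balls. -/
def HasIncreasingBalls (M : Type*) [MetricSpace M] : Prop :=
  ∃ B : ℕ → Set M, (∀ n, IsBallSet (B n)) ∧ ∀ n, B n ⊂ B (n + 1)

/-- A metric space is indivisible if, whenever it is partitioned into two parts, one of the two
parts contains an isometric copy of the whole space. -/
def MetricIndivisible (M : Type*) [MetricSpace M] : Prop :=
  ∀ P Q : Set M, P ∪ Q = Set.univ → Disjoint P Q →
    (∃ f : M → M, Isometry f ∧ Set.range f ⊆ P) ∨ (∃ f : M → M, Isometry f ∧ Set.range f ⊆ Q)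

/-- A metric space is hereditarily indivisible if it and all its balls are indivisible. -/
def HereditarilyMetricIndivisible (M : Type*) [MetricSpace M] : Prop :=
  MetricIndivisible M ∧ ∀ B : Set M, IsBallSet B → MetricIndivisible B

/-- `f` is a local spec-embedding of `M` with domain `A`: an isometry from the subspace `A` onto a
subspace of `M` such that the spectrum (in `M`) of each `x ∈ A` is contained in that of `f x`. -/
def IsLocalSpecEmbedding {M : Type*} [MetricSpace M] (A : Set M) (f : A → M) : Prop :=
  Isometry f ∧ ∀ x : A, pointDistSpec (x : M) ⊆ pointDistSpec (f x)

/-- A metric space is spec-endogeneous if every local spec-embedding with finite domain extends to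
an isometric embedding of the space into itself. -/
def SpecEndogeneous (M : Type*) [MetricSpace M] : Prop :=
  ∀ (A : Set M) (f : A → M), A.Finite → IsLocalSpecEmbedding A f →
    ∃ g : M → M, Isometry g ∧ ∀ x : A, g x = f x

/-! Strictly increasing balls give a point `a` and points `x n` with `dist a (x n) = s n` strictly
increasing. An indivisible ultrametric space contains no such configuration: call two points
equivalent if they are closer than some `s n`, choose a representative of each class, and colour a
point by the parity of the scale of its distance to the representative. Along any isometric image of
`x` both parities occur (`MetricIndivisible.not_strictMono`).

Without such balls, point spectra have no infinite increasing sequence. Then `N` is `LabelSpace o`: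
finitely supported families of multisets of points of `M`, at distance the largest place where they
differ. A label separates branches and also admits, below its place, the distances of the points in
it. All else follows from `AmplyBranching`. An isometry grows greedily, each new point branching off
from the image of a nearest old one; this gives extension and embedding. For indivisibility the
greedy choices must stay in one colour class, which is what a plan guarantees. A radius is bad if no
colour has a plan reserving it in the ball. Below a bad ball neither colour can be pursued
everywhere, since the pursuit would itself be a plan (`AmplyBranching.false_of_pursuit`); but some
colour is always pursuable (`AmplyBranching.exists_isPursuable`). Hence no radius is bad, and each
ball is copied into one colour. -/

section Ultrametric

variable {N : Type*} [MetricSpace N]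

lemma zero_mem_pointDistSpec (u : N) : (0 : ℝ) ∈ pointDistSpec u := ⟨u, dist_self u⟩

lemma nonneg_of_mem_pointDistSpec {u : N} {r : ℝ} (h : r ∈ pointDistSpec u) : 0 ≤ r := by
  obtain ⟨x, rfl⟩ := h
  exact dist_nonneg

variable [IsUltrametricDist N]

lemma dist_le_of_le_of_le {x y z : N} {r : ℝ} (h : dist x y ≤ r) (h' : dist y z ≤ r) :
    dist x z ≤ r :=
  (dist_triangle_max x y z).trans (max_le h h')

lemma le_dist_of_dist_lt {x y z : N} {r : ℝ} (h : dist x y < r) (h' : r ≤ dist x z) :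
    r ≤ dist y z := by
  rcases le_max_iff.1 (h'.trans (dist_triangle_max x y z)) with h1 | h1
  · exact absurd h1 h.not_ge
  · exact h1

lemma mem_pointDistSpec_of_dist_le {u v : N} {r : ℝ} (h : r ∈ pointDistSpec u)
    (huv : dist u v ≤ r) : r ∈ pointDistSpec v := by
  obtain ⟨y, hy⟩ := h
  rcases huv.eq_or_lt with h1 | h1
  · exact ⟨u, by rw [dist_comm, h1]⟩
  · refine ⟨y, le_antisymm (dist_le_of_le_of_le (y := u) (by rw [dist_comm]; exact huv) hy.le) ?_⟩
    exact le_dist_of_dist_lt h1 hy.ge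

end Ultrametric

/-! ### Amply branching spaces and plans -/

/-- A metric space in which every sphere around a point branches infinitely often, each time with
at least the small distances available anywhere in the space, in which point spectra are dually
well-founded and directed under inclusion. -/
structure AmplyBranching (N : Type*) [MetricSpace N] : Prop where
  exists_branch : ∀ (u w : N) (r : ℝ), r ∈ pointDistSpec u → 0 < r → ∀ F : Finset N,
    ∃ v, dist u v = r ∧ (∀ y ∈ F, r ≤ dist v y) ∧
      ∀ q ∈ pointDistSpec w, q < r → q ∈ pointDistSpec v
  wellFoundedOn : ∀ u : N, (pointDistSpec u).WellFoundedOn (· > ·)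
  directed : ∀ u w : N, ∃ z : N,
    pointDistSpec u ⊆ pointDistSpec z ∧ pointDistSpec w ⊆ pointDistSpec z

lemma Set.WellFoundedOn.exists_greatest {S A : Set ℝ} (hS : S.WellFoundedOn (· > ·)) (hA : A ⊆ S)
    (hne : A.Nonempty) : ∃ m ∈ A, ∀ a ∈ A, a ≤ m := by
  obtain ⟨m, hm, h⟩ := (hS.subset hA).has_min (Set.univ : Set A) ⟨⟨_, hne.some_mem⟩, trivial⟩
  exact ⟨m, m.2, fun a ha => not_lt.1 (h ⟨a, ha⟩ trivial)⟩

/-- A family of positions `(v, S)`, with `v` in `P` and `S` a set of reserved distances, such that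
from each position one can branch off at any reserved distance, staying in the family. -/
def IsPlan {N : Type*} [MetricSpace N] (P : Set N) (G : N → Set ℝ → Prop) : Prop :=
  ∀ v S, G v S → v ∈ P ∧ ∀ r ∈ S, 0 < r → ∀ (w : N) (F : Finset N), ∃ v' S', G v' S' ∧
    dist v v' = r ∧ (∀ y ∈ F, r ≤ dist v' y) ∧ (∀ q ∈ S, r ≤ q → q ∈ S') ∧
    ∀ q ∈ pointDistSpec w, q < r → q ∈ S'

/-- A finite partial isometry following a plan. -/
def IsPartialCopy {X N : Type*} [MetricSpace X] [MetricSpace N] (G : N → Set ℝ → Prop)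
    (A : Finset X) (f : X → N) : Prop :=
  (∀ a ∈ A, ∀ b ∈ A, dist (f a) (f b) = dist a b) ∧
    ∀ a ∈ A, ∃ S, G (f a) S ∧ pointDistSpec a ⊆ S

/-! ### Greedy extension of partial isometries -/

section Greedy

variable {X N : Type*} [MetricSpace X] [IsUltrametricDist X] [MetricSpace N] [IsUltrametricDist N]
  {P : Set N} {G : N → Set ℝ → Prop}

-- Branch off from the image of a point `a` of `A` nearest to `x`, at distance `dist x a` and no
-- closer to any other image; the ultrametric inequality then forces all remaining distances.
-- Distances of `x` from `dist x a` upwards are already reserved at `a`; the smaller ones come from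
-- `w`.
open Classical in
lemma IsPartialCopy.exists_insert (hG : IsPlan P G)
    (hX : ∀ x : X, ∃ w : N, pointDistSpec x ⊆ pointDistSpec w) {A : Finset X} (hA : A.Nonempty)
    {f : X → N} (hf : IsPartialCopy G A f) (x : X) :
    ∃ f', IsPartialCopy G (insert x A) f' ∧ ∀ a ∈ A, f' a = f a := by
  by_cases hx : x ∈ A
  · exact ⟨f, by rwa [Finset.insert_eq_of_mem hx], fun _ _ => rfl⟩
  obtain ⟨a, ha, hmin⟩ := Finset.exists_min_image A (dist x) hA
  obtain ⟨S, hS, haS⟩ := hf.2 a ha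
  obtain ⟨w, hw⟩ := hX x
  have hr : 0 < dist x a := dist_pos.2 fun h => hx (h ▸ ha)
  obtain ⟨v, S', hv, hd, hF, hS', hwS⟩ :=
    (hG _ _ hS).2 (dist x a) (haS ⟨x, dist_comm a x⟩) hr w (A.image f)
  have key : ∀ b ∈ A, dist v (f b) = dist x b := by
    intro b hb
    have h1 : dist x a ≤ dist v (f b) := hF _ (Finset.mem_image_of_mem f hb)
    have h2 : dist a b ≤ dist x b :=
      dist_le_of_le_of_le (y := x) (by rw [dist_comm]; exact hmin b hb) le_rfl
    have h3 : dist v (f b) ≤ dist x b :=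
      dist_le_of_le_of_le (y := f a) (by rw [dist_comm, hd]; exact hmin b hb)
        (by rw [hf.1 a ha b hb]; exact h2)
    rcases (hmin b hb).eq_or_lt with h | h
    · exact le_antisymm h3 (h ▸ h1)
    · refine le_antisymm h3 (le_dist_of_dist_lt (x := f a) (by rw [hd]; exact h) ?_)
      rw [hf.1 a ha b hb]
      exact le_dist_of_dist_lt h le_rfl
  have hne : ∀ b ∈ A, b ≠ x := fun b hb h => hx (h ▸ hb)
  refine ⟨Function.update f x v, ⟨?_, ?_⟩, fun b hb => Function.update_of_ne (hne b hb) _ _⟩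
  · intro b hb c hc
    rcases Finset.mem_insert.1 hb with rfl | hb' <;> rcases Finset.mem_insert.1 hc with rfl | hc'
    · simp
    · rw [Function.update_self, Function.update_of_ne (hne c hc'), key c hc']
    · rw [Function.update_self, Function.update_of_ne (hne b hb'), dist_comm, key b hb', dist_comm]
    · rw [Function.update_of_ne (hne c hc'), Function.update_of_ne (hne b hb'), hf.1 b hb' c hc']
  · intro b hb
    rcases Finset.mem_insert.1 hb with rfl | hb
    · refine ⟨S', by rwa [Function.update_self], fun q hq => ?_⟩
      rcases lt_or_ge q (dist b a) with h | h
      · exact hwS q (hw hq) h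
      · exact hS' q (haS (mem_pointDistSpec_of_dist_le hq h)) h
    · rw [Function.update_of_ne (hne b hb)]
      exact hf.2 b hb

open Classical in
/-- A nonempty finite partial copy of a countable ultrametric space along a plan extends to a copy
of the whole space inside the set on which the plan lives. -/
lemma IsPartialCopy.exists_isometry [Countable X] (hG : IsPlan P G)
    (hX : ∀ x : X, ∃ w : N, pointDistSpec x ⊆ pointDistSpec w) {A : Finset X} (hA : A.Nonempty)
    {f : X → N} (hf : IsPartialCopy G A f) :
    ∃ g : X → N, Isometry g ∧ Set.range g ⊆ P ∧ ∀ a ∈ A, g a = f a := by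
  have : Nonempty X := ⟨hA.choose⟩
  obtain ⟨e, he⟩ := exists_surjective_nat X
  let State := {p : Finset X × (X → N) // p.1.Nonempty ∧ IsPartialCopy G p.1 p.2}
  have hstep : ∀ (p : State) (x : X), ∃ p' : State,
      p'.1.1 = insert x p.1.1 ∧ ∀ a ∈ p.1.1, p'.1.2 a = p.1.2 a := by
    intro p x
    obtain ⟨f', h1, h2⟩ := p.2.2.exists_insert hG hX p.2.1 x
    exact ⟨⟨(_, f'), Finset.insert_nonempty _ _, h1⟩, rfl, h2⟩
  choose next hnext1 hnext2 using hstep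
  let s : ℕ → State := fun n => Nat.rec ⟨(A, f), hA, hf⟩ (fun n p => next p (e n)) n
  have hsucc : ∀ n, s (n + 1) = next (s n) (e n) := fun n => rfl
  have hmem : ∀ {m n}, m ≤ n → ∀ a ∈ (s m).1.1, a ∈ (s n).1.1 ∧ (s n).1.2 a = (s m).1.2 a := by
    intro m n hmn a ha
    induction n, hmn using Nat.le_induction with
    | base => exact ⟨ha, rfl⟩
    | succ n _ ih =>
      refine ⟨?_, ?_⟩
      · rw [hsucc, hnext1]
        exact Finset.mem_insert_of_mem ih.1
      · rw [hsucc, hnext2 _ _ _ ih.1, ih.2]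
  choose i hi using he
  have hin : ∀ x, x ∈ (s (i x + 1)).1.1 := fun x => by
    rw [hsucc, hnext1, hi]
    exact Finset.mem_insert_self _ _
  refine ⟨fun x => (s (i x + 1)).1.2 x, Isometry.of_dist_eq fun x y => ?_, ?_, fun a ha => ?_⟩
  · obtain ⟨hx, hx'⟩ := hmem (le_max_left (i x + 1) (i y + 1)) x (hin x)
    obtain ⟨hy, hy'⟩ := hmem (le_max_right (i x + 1) (i y + 1)) y (hin y)
    rw [← hx', ← hy']
    exact (s _).2.2.1 _ hx _ hy
  · rintro _ ⟨x, rfl⟩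
    obtain ⟨S, hS, -⟩ := (s (i x + 1)).2.2.2 x (hin x)
    exact (hG _ _ hS).1
  · exact (hmem (Nat.zero_le (i a + 1)) a ha).2

end Greedy

/-! ### Spec-endogeneity and embeddings -/

section

variable {N : Type*} [MetricSpace N] [IsUltrametricDist N]

lemma AmplyBranching.isPlan_subset_pointDistSpec (hN : AmplyBranching N) :
    IsPlan (Set.univ : Set N) fun v S => S ⊆ pointDistSpec v := by
  refine fun v S hS => ⟨trivial, fun r hr hr0 w F => ?_⟩
  obtain ⟨v', h1, h2, h3⟩ := hN.exists_branch v w r (hS hr) hr0 F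
  exact ⟨v', pointDistSpec v', subset_rfl, h1, h2,
    fun q hq hrq => mem_pointDistSpec_of_dist_le (hS hq) (h1.trans_le hrq), h3⟩

open Classical in
lemma AmplyBranching.specEndogeneous [Countable N] (hN : AmplyBranching N) :
    SpecEndogeneous N := by
  intro A f hA hf
  rcases A.eq_empty_or_nonempty with rfl | ⟨a, ha⟩
  · exact ⟨id, isometry_id, fun x => x.2.elim⟩
  have h0 : IsPartialCopy (fun (v : N) S => S ⊆ pointDistSpec v) hA.toFinset
      (fun x => if h : x ∈ A then f ⟨x, h⟩ else x) := by
    refine ⟨fun x hx y hy => ?_, fun x hx => ?_⟩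
    · rw [hA.mem_toFinset] at hx hy
      simp only [hx, hy, dif_pos]
      exact hf.1.dist_eq _ _
    · rw [hA.mem_toFinset] at hx
      simp only [hx, dif_pos]
      exact ⟨_, hf.2 ⟨x, hx⟩, subset_rfl⟩
  obtain ⟨g, h1, -, h3⟩ := h0.exists_isometry hN.isPlan_subset_pointDistSpec
    (fun x => ⟨x, subset_rfl⟩) ⟨a, hA.mem_toFinset.2 ha⟩
  refine ⟨g, h1, fun x => ?_⟩
  rw [h3 x (hA.mem_toFinset.2 x.2), dif_pos x.2]

lemma AmplyBranching.exists_isometry {X : Type*} [MetricSpace X] [IsUltrametricDist X]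
    [Countable X] [Nonempty X] (hN : AmplyBranching N)
    (hX : ∀ x : X, ∃ w : N, pointDistSpec x ⊆ pointDistSpec w) : ∃ f : X → N, Isometry f := by
  obtain ⟨x⟩ := ‹Nonempty X›
  obtain ⟨w, hw⟩ := hX x
  have h0 : IsPartialCopy (fun (v : N) S => S ⊆ pointDistSpec v) {x} (fun _ : X => w) := by
    refine ⟨fun a ha b hb => ?_, fun a ha => ?_⟩
    · rw [Finset.mem_singleton.1 ha, Finset.mem_singleton.1 hb, dist_self, dist_self]
    · exact ⟨_, subset_rfl, by rwa [Finset.mem_singleton.1 ha]⟩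
  obtain ⟨g, h1, -, -⟩ := h0.exists_isometry hN.isPlan_subset_pointDistSpec hX
    (Finset.singleton_nonempty x)
  exact ⟨g, h1⟩

end

/-! ### Indivisibility of balls -/

/-- The position `(v, S)` belongs to some plan on `P`. -/
def Sustains {N : Type*} [MetricSpace N] (P : Set N) (v : N) (S : Set ℝ) : Prop :=
  ∃ G, IsPlan P G ∧ G v S

/-- No point of the closed ball around `u` of radius `r` has, for any of the colours, a sustained
position reserving the distance `r`. -/
def IsBadRadius {N : Type*} [MetricSpace N] (C : Bool → Set N) (u : N) (r : ℝ) : Prop :=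
  r ∈ pointDistSpec u ∧ ∀ i v S, dist u v ≤ r → r ∈ S → ¬ Sustains (C i) v S

/-- At `v`, every distance in `S` is either sustained for the colour `i`, or such that it and all
larger distances in `S` are bad. -/
def IsPursuable {N : Type*} [MetricSpace N] (C : Bool → Set N) (i : Bool) (v : N) (S : Set ℝ) :
    Prop :=
  ∃ S', Sustains (C i) v S' ∧ ∀ q ∈ S, q ∈ S' ∨ ∀ p ∈ S, q ≤ p → IsBadRadius C v p

section Indivisible

variable {N : Type*} [MetricSpace N] {P : Set N} {C : Bool → Set N}

/-- A union of plans is a plan, so `Sustains P` is the largest plan on `P`, and any plan through a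
position shows it sustained. -/
lemma isPlan_sustains : IsPlan P (Sustains P) := by
  rintro v S ⟨G, hG, hS⟩
  refine ⟨(hG v S hS).1, fun r hr hr0 w F => ?_⟩
  obtain ⟨v', S', h1, h2⟩ := (hG v S hS).2 r hr hr0 w F
  exact ⟨v', S', ⟨G, hG, h1⟩, h2⟩

lemma sustains_empty {v : N} (hv : v ∈ P) : Sustains P v ∅ := by
  refine ⟨fun v S => v ∈ P ∧ S = ∅, ?_, hv, rfl⟩
  rintro v S ⟨hv, rfl⟩
  exact ⟨hv, fun r hr => hr.elim⟩

lemma Sustains.exists_of_lt {v w : N} {S : Set ℝ} {s q : ℝ} (h : Sustains P v S) (hs : s ∈ S)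
    (hq : q ∈ pointDistSpec w) (hqs : q < s) :
    ∃ v' S', Sustains P v' S' ∧ dist v v' = s ∧ q ∈ S' := by
  obtain ⟨v', S', h1, h2, -, -, h3⟩ := (isPlan_sustains v S h).2 s hs
    ((nonneg_of_mem_pointDistSpec hq).trans_lt hqs) w ∅
  exact ⟨v', S', h1, h2, h3 q hq hqs⟩

/-- A sustained position reserving `r` can be changed to one that also reserves all distances below
`r` that occur at `w`. -/
lemma Sustains.exists_superset {v : N} {S : Set ℝ} {r : ℝ} (h : Sustains P v S) (hr : r ∈ S)
    (hr0 : 0 ≤ r) (w : N) :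
    ∃ v' S', Sustains P v' S' ∧ dist v v' ≤ r ∧ ∀ q ∈ pointDistSpec w, q ≤ r → q ∈ S' := by
  rcases hr0.eq_or_lt with rfl | hr0
  · refine ⟨v, S, h, (dist_self v).le, fun q hq hq0 => ?_⟩
    rwa [hq0.antisymm (nonneg_of_mem_pointDistSpec hq)]
  · obtain ⟨v', S', h1, h2, -, h3, h4⟩ := (isPlan_sustains v S h).2 r hr hr0 w ∅
    refine ⟨v', S', h1, h2.le, fun q hq hqr => ?_⟩
    rcases hqr.eq_or_lt with rfl | hqr
    · exact h3 q hr le_rfl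
    · exact h4 q hq hqr

lemma AmplyBranching.exists_eq_closedBall (hN : AmplyBranching N) {B : Set N} (hB : IsBallSet B) :
    ∃ u s, s ∈ pointDistSpec u ∧ B = Metric.closedBall u s := by
  obtain ⟨u, r, ⟨hr, rfl⟩ | ⟨hr, rfl⟩⟩ := hB
  · obtain ⟨s, ⟨hs, hsr⟩, hmax⟩ := (hN.wellFoundedOn u).exists_greatest
      (A := {q ∈ pointDistSpec u | q < r}) (fun q hq => hq.1) ⟨0, zero_mem_pointDistSpec u, hr⟩
    refine ⟨u, s, hs, Set.ext fun x => ?_⟩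
    rw [Metric.mem_ball', Metric.mem_closedBall']
    exact ⟨fun h => hmax _ ⟨⟨x, rfl⟩, h⟩, fun h => h.trans_lt hsr⟩
  · obtain ⟨s, ⟨hs, hsr⟩, hmax⟩ := (hN.wellFoundedOn u).exists_greatest
      (A := {q ∈ pointDistSpec u | q ≤ r}) (fun q hq => hq.1) ⟨0, zero_mem_pointDistSpec u, hr⟩
    refine ⟨u, s, hs, Set.ext fun x => ?_⟩
    rw [Metric.mem_closedBall', Metric.mem_closedBall']
    exact ⟨fun h => hmax _ ⟨⟨x, rfl⟩, h⟩, fun h => h.trans hsr⟩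

variable [IsUltrametricDist N]

-- Otherwise every `w` and `F` would allow a sustained position off `F` reserving all distances of
-- `w` below `s`: apply the failure to the largest such distance. These positions, with `s` added to
-- the reservation, would form a plan reserving `s`.
open Classical in
lemma AmplyBranching.exists_not_sustains (hN : AmplyBranching N) {u : N} {s : ℝ} (hs : 0 < s)
    (h : ∀ v S, dist u v ≤ s → s ∈ S → ¬ Sustains P v S) :
    ∃ (q : ℝ) (w : N) (F : Finset N), q ∈ pointDistSpec w ∧ q < s ∧
      ∀ v S, dist u v ≤ s → (∀ y ∈ F, s ≤ dist v y) → q ∈ S → ¬ Sustains P v S := by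
  by_contra! H
  have key : ∀ (w : N) (F : Finset N), ∃ v S, dist u v ≤ s ∧ (∀ y ∈ F, s ≤ dist v y) ∧
      Sustains P v S ∧ ∀ q ∈ pointDistSpec w, q < s → q ∈ S := by
    intro w F
    obtain ⟨q, ⟨hq, hqs⟩, hmax⟩ := (hN.wellFoundedOn w).exists_greatest
      (A := {q ∈ pointDistSpec w | q < s}) (fun q hq => hq.1) ⟨0, zero_mem_pointDistSpec w, hs⟩
    obtain ⟨v, S, h1, h2, h3, h4⟩ := H q w F hq hqs
    obtain ⟨v', S', h5, h6, h7⟩ := h4.exists_superset h3 (nonneg_of_mem_pointDistSpec hq) w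
    exact ⟨v', S', dist_le_of_le_of_le h1 (h6.trans hqs.le),
      fun y hy => le_dist_of_dist_lt (h6.trans_lt hqs) (h2 y hy), h5,
      fun p hp hps => h7 p hp (hmax p ⟨hp, hps⟩)⟩
  have hG : IsPlan P fun v R => dist u v ≤ s ∧ ∃ S, Sustains P v S ∧
      ∀ q ∈ R, q = s ∨ q < s ∧ q ∈ S := by
    rintro v R ⟨huv, S, hS, hR⟩
    refine ⟨(isPlan_sustains v S hS).1, fun r hr hr0 w F => ?_⟩
    rcases hR r hr with rfl | ⟨hrs, hrS⟩
    -- Avoiding `v` too makes the distance from `v` exactly `r`.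
    · obtain ⟨v', S', h1, h2, h3, h4⟩ := key w (insert v F)
      refine ⟨v', {q | q = r ∨ q < r ∧ q ∈ S'}, ⟨h1, S', h3, fun q hq => hq⟩,
        le_antisymm (dist_le_of_le_of_le (y := u) (by rwa [dist_comm]) h1) ?_,
        fun y hy => h2 y (Finset.mem_insert_of_mem hy), fun q hq hrq => ?_,
        fun q hq hqr => Or.inr ⟨hqr, h4 q hq hqr⟩⟩
      · rw [dist_comm]
        exact h2 v (Finset.mem_insert_self _ _)
      · rcases hR q hq with h | h
        · exact Or.inl h
        · exact absurd h.1 hrq.not_gt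
    · obtain ⟨v', S', h1, h2, h3, h4, h5⟩ := (isPlan_sustains v S hS).2 r hrS hr0 w F
      refine ⟨v', {q | q = s ∨ q < s ∧ q ∈ S'},
        ⟨dist_le_of_le_of_le huv (h2.le.trans hrs.le), S', h1, fun q hq => hq⟩, h2, h3,
        fun q hq hrq => ?_, fun q hq hqr => Or.inr ⟨hqr.trans hrs, h5 q hq hqr⟩⟩
      rcases hR q hq with h | h
      · exact Or.inl h
      · exact Or.inr ⟨h.1, h4 q h.2 hrq⟩
  obtain ⟨v, S, h1, -, h2, -⟩ := key u ∅
  exact h v {s} h1 rfl ⟨_, hG, h1, S, h2, fun q hq => Or.inl hq⟩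

lemma IsBadRadius.of_dist_le {u v : N} {r : ℝ} (h : IsBadRadius C u r) (huv : dist u v ≤ r) :
    IsBadRadius C v r :=
  ⟨mem_pointDistSpec_of_dist_le h.1 huv,
    fun i x S hx hr => h.2 i x S (dist_le_of_le_of_le huv hx) hr⟩

-- The larger of the two colours' thresholds serves both: a sustained position reserving it can
-- branch to one reserving the smaller threshold.
open Classical in
lemma AmplyBranching.exists_not_sustains_of_isBadRadius (hN : AmplyBranching N) {u : N} {s : ℝ}
    (hs : 0 < s) (h : IsBadRadius C u s) :
    ∃ (q : ℝ) (w : N) (F : Finset N), q ∈ pointDistSpec w ∧ q < s ∧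
      ∀ i v S, dist u v ≤ s → (∀ y ∈ F, s ≤ dist v y) → q ∈ S → ¬ Sustains (C i) v S := by
  choose q w F hq hqs hF using fun i => hN.exists_not_sustains hs (h.2 i)
  have key : ∀ p, (∀ i, q i ≤ p) → p < s → ∀ i v S, dist u v ≤ s →
      (∀ y ∈ F true ∪ F false, s ≤ dist v y) → p ∈ S → ¬ Sustains (C i) v S := by
    intro p hp hps i v S huv hv hpS hS
    have hv' : ∀ y ∈ F i, s ≤ dist v y := fun y hy => hv y (by cases i <;> simp [hy])
    rcases (hp i).eq_or_lt with h1 | h1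
    · exact hF i v S huv hv' (h1 ▸ hpS) hS
    · obtain ⟨v', S', h2, h3, h4⟩ := hS.exists_of_lt hpS (hq i) h1
      exact hF i v' S' (dist_le_of_le_of_le huv (h3.le.trans hps.le))
        (fun y hy => le_dist_of_dist_lt (h3.trans_lt hps) (hv' y hy)) h4 h2
  rcases le_total (q true) (q false) with h1 | h1
  · exact ⟨_, _, _, hq false, hqs false, key _ (by rintro (_ | _) <;> simp [h1]) (hqs false)⟩
  · exact ⟨_, _, _, hq true, hqs true, key _ (by rintro (_ | _) <;> simp [h1]) (hqs true)⟩

lemma AmplyBranching.exists_isPursuable (hN : AmplyBranching N) (hC : ∀ v, ∃ i, v ∈ C i) {u : N}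
    {S : Set ℝ} {s : ℝ} (hS : S ⊆ pointDistSpec u) (hs : 0 ≤ s)
    (hbad : ∀ q ∈ S, s ≤ q → IsBadRadius C u q) :
    ∃ i v, dist u v ≤ s ∧ IsPursuable C i v S := by
  by_cases h : ∀ q ∈ S, IsBadRadius C u q
  · obtain ⟨i, hi⟩ := hC u
    exact ⟨i, u, by rwa [dist_self], ∅, sustains_empty hi,
      fun q _ => Or.inr fun p hp _ => h p hp⟩
  push Not at h
  -- Split `S` at its largest distance that is not bad: everything up to `r` can be sustained at
  -- once, everything above is bad.
  obtain ⟨r, ⟨hrS, hr⟩, hmax⟩ := (hN.wellFoundedOn u).exists_greatest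
    (A := {q ∈ S | ¬ IsBadRadius C u q}) (fun q hq => hS hq.1) h
  have hrs : r < s := not_le.1 fun h => hr (hbad r hrS h)
  obtain ⟨i, v, S', h1, h2, h3⟩ : ∃ i v S', dist u v ≤ r ∧ r ∈ S' ∧ Sustains (C i) v S' := by
    by_contra! H
    exact hr ⟨hS hrS, H⟩
  obtain ⟨v', S'', h4, h5, h6⟩ := h3.exists_superset h2 (nonneg_of_mem_pointDistSpec (hS hrS)) u
  have hv' : dist u v' ≤ r := dist_le_of_le_of_le h1 h5
  refine ⟨i, v', hv'.trans hrs.le, S'', h4, fun q hq => ?_⟩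
  rcases le_or_gt q r with h | h
  · exact Or.inl (h6 q (hS hq) h)
  · refine Or.inr fun p hp hqp => ?_
    have hbp : IsBadRadius C u p := by
      by_contra hbp
      exact (h.trans_le hqp).not_ge (hmax p ⟨hp, hbp⟩)
    exact hbp.of_dist_le (hv'.trans (h.le.trans hqp))

open Classical in
/-- If pursuable points for the colour `i` are available in all relevant balls below a bad ball,
then following them gives a plan, contradicting badness. -/
lemma AmplyBranching.false_of_pursuit (hN : AmplyBranching N) {i : Bool} {u₀ : N} {s₀ : ℝ}
    {t : Set ℝ} (hs : s₀ ∈ t) (htu : t ⊆ pointDistSpec u₀) (hts : ∀ q ∈ t, q ≤ s₀)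
    (hbad : ∀ q ∈ t, s₀ ≤ q → IsBadRadius C u₀ q)
    (H : ∀ u S r, dist u₀ u ≤ s₀ → t ⊆ S → S ⊆ pointDistSpec u → (∀ q ∈ S, q ≤ s₀) → r ∈ S →
      (∀ q ∈ S, r ≤ q → IsBadRadius C u q) → ∃ v, dist u v ≤ r ∧ IsPursuable C i v S) :
    False := by
  have hs₀ : 0 ≤ s₀ := nonneg_of_mem_pointDistSpec (htu hs)
  have hG : IsPlan (C i) fun v S => dist u₀ v ≤ s₀ ∧ IsPursuable C i v S ∧ t ⊆ S ∧
      ∀ q ∈ S, q ≤ s₀ := by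
    rintro v S ⟨huv, ⟨S', hS', hSS'⟩, htS, hSs⟩
    refine ⟨(isPlan_sustains v S' hS').1, fun r hr hr0 w F => ?_⟩
    -- If the distances from `r` upwards are bad, branch in the space itself, away from `Fq`. There
    -- all reserved distances from `q` to `r` are bad as well, so `H` applies at radius `q < r`, and
    -- moving by at most `q` preserves the branching.
    by_cases hrb : ∀ p ∈ S, r ≤ p → IsBadRadius C v p
    · obtain ⟨q, wq, Fq, hq, hqr, hFq⟩ := hN.exists_not_sustains_of_isBadRadius hr0 (hrb r hr le_rfl)
      -- The spectrum of `z'` contains those of `u₀` (to keep `t` reserved), `w` (as requested) and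
      -- `wq` (to reserve `q`).
      obtain ⟨z, hz₀, hzw⟩ := hN.directed u₀ w
      obtain ⟨z', hzz', hqz'⟩ := hN.directed z wq
      obtain ⟨u, hvu, hFu, hu⟩ := hN.exists_branch v z' r (hrb r hr le_rfl).1 hr0 (F ∪ Fq)
      have hu₀ : dist u₀ u ≤ s₀ := dist_le_of_le_of_le huv (hvu.le.trans (hSs r hr))
      obtain ⟨v', h1, h2⟩ := H u {p | p ∈ S ∧ r ≤ p ∨ p ∈ pointDistSpec z' ∧ p < r} q hu₀
        (fun p hp => (le_or_gt r p).imp (fun h => ⟨htS hp, h⟩)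
          fun h => ⟨hzz' (hz₀ (htu hp)), h⟩)
        (by
          rintro p (⟨hp, hrp⟩ | ⟨hp, hpr⟩)
          · exact mem_pointDistSpec_of_dist_le (hrb p hp hrp).1 (hvu.le.trans hrp)
          · exact hu p hp hpr)
        (by
          rintro p (⟨hp, hrp⟩ | ⟨hp, hpr⟩)
          · exact hSs p hp
          · exact hpr.le.trans (hSs r hr))
        (Or.inr ⟨hqz' hq, hqr⟩)
        (by
          rintro p (⟨hp, hrp⟩ | ⟨hp, hpr⟩) hqp
          · exact (hrb p hp hrp).of_dist_le (hvu.le.trans hrp)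
          · refine ⟨hu p hp hpr, fun j x R hx hpR hR => ?_⟩
            have hfar : ∀ y ∈ Fq, r ≤ dist x y := fun y hy =>
              le_dist_of_dist_lt (hx.trans_lt hpr) (hFu y (Finset.mem_union_right _ hy))
            have hvx : dist v x ≤ r := dist_le_of_le_of_le hvu.le (hx.trans hpr.le)
            rcases hqp.eq_or_lt with rfl | hqp
            · exact hFq j x R hvx hfar hpR hR
            · obtain ⟨x', R', h2, h3, h4⟩ := hR.exists_of_lt hpR hq hqp
              exact hFq j x' R' (dist_le_of_le_of_le hvx (h3.le.trans hpr.le))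
                (fun y hy => le_dist_of_dist_lt (h3.trans_lt hpr) (hfar y hy)) h4 h2)
      have huv' : dist u v' < r := h1.trans_lt hqr
      refine ⟨v', _, ⟨dist_le_of_le_of_le hu₀ (h1.trans (hqr.le.trans (hSs r hr))), h2, ?_, ?_⟩,
        le_antisymm (dist_le_of_le_of_le hvu.le huv'.le) ?_,
        fun y hy => le_dist_of_dist_lt huv' (hFu y (Finset.mem_union_left _ hy)),
        fun p hp hrp => Or.inl ⟨hp, hrp⟩, fun p hp hpr => Or.inr ⟨hzz' (hzw hp), hpr⟩⟩
      · exact fun p hp => (le_or_gt r p).imp (fun h => ⟨htS hp, h⟩)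
          fun h => ⟨hzz' (hz₀ (htu hp)), h⟩
      · rintro p (⟨hp, hrp⟩ | ⟨hp, hpr⟩)
        · exact hSs p hp
        · exact hpr.le.trans (hSs r hr)
      · rw [dist_comm]
        exact le_dist_of_dist_lt huv' (by rw [dist_comm, hvu])
    -- Otherwise `r` is sustained, and the sustaining plan provides the branch.
    · have hrS' : r ∈ S' := (hSS' r hr).resolve_right hrb
      obtain ⟨z, hz₀, hzw⟩ := hN.directed u₀ w
      obtain ⟨v', S'', h1, h2, h3, h4, h5⟩ := (isPlan_sustains v S' hS').2 r hrS' hr0 z F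
      refine ⟨v', {p | p ∈ S ∧ r ≤ p ∨ p ∈ pointDistSpec z ∧ p < r},
        ⟨dist_le_of_le_of_le huv (h2.le.trans (hSs r hr)), ⟨S'', h1, ?_⟩, ?_, ?_⟩, h2, h3,
        fun p hp hrp => Or.inl ⟨hp, hrp⟩, fun p hp hpr => Or.inr ⟨hzw hp, hpr⟩⟩
      · rintro p (⟨hp, hrp⟩ | ⟨hp, hpr⟩)
        · refine (hSS' p hp).imp (fun h => h4 p h hrp) fun h => ?_
          rintro p' (⟨hp', hrp'⟩ | ⟨hp', hpr'⟩) hpp'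
          · exact (h p' hp' hpp').of_dist_le (h2.le.trans hrp')
          · exact absurd (hrp.trans hpp') hpr'.not_ge
        · exact Or.inl (h5 p hp hpr)
      · exact fun p hp => (le_or_gt r p).imp (fun h => ⟨htS hp, h⟩) fun h => ⟨hz₀ (htu hp), h⟩
      · rintro p (⟨hp, hrp⟩ | ⟨hp, hpr⟩)
        · exact hSs p hp
        · exact hpr.le.trans (hSs r hr)
  obtain ⟨v, h1, h2⟩ := H u₀ t s₀ (by rwa [dist_self]) subset_rfl htu hts hs hbad
  exact (hbad s₀ hs le_rfl).2 i v t h1 hs ⟨_, hG, h1, h2, subset_rfl, hts⟩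

lemma AmplyBranching.not_isBadRadius (hN : AmplyBranching N) (hC : ∀ v, ∃ i, v ∈ C i) (u₀ : N)
    (s₀ : ℝ) : ¬ IsBadRadius C u₀ s₀ := by
  intro hbad
  -- Pursue `true` first. Where this fails, at `u` with radius `r`, pursue `false`, keeping the part
  -- of `S` up to `r` reserved; a point pursuable for `true` there would be pursuable for all of
  -- `S`, since larger distances are bad.
  refine hN.false_of_pursuit (C := C) (i := true) (t := {s₀}) (u₀ := u₀) (s₀ := s₀) rfl
    (by rintro q rfl; exact hbad.1) (by rintro q rfl; exact le_rfl) (by rintro q rfl _; exact hbad)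
    fun u S r _ _ hSu _ hrS hSb => ?_
  by_contra! hno
  have hr0 : 0 ≤ r := nonneg_of_mem_pointDistSpec (hSu hrS)
  refine hN.false_of_pursuit (C := C) (i := false) (t := {q ∈ S | q ≤ r}) (u₀ := u) (s₀ := r)
    ⟨hrS, le_rfl⟩ (fun q hq => hSu hq.1) (fun q hq => hq.2) (fun q hq => hSb q hq.1)
    fun u' S' r' huu' hSS' hSu' hSr hrS' hSb' => ?_
  have hr0' : 0 ≤ r' := nonneg_of_mem_pointDistSpec (hSu' hrS')
  obtain ⟨i, v, h1, h2⟩ := hN.exists_isPursuable hC hSu' hr0' hSb'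
  cases i with
  | false => exact ⟨v, h1, h2⟩
  | true =>
    have huv : dist u v ≤ r := dist_le_of_le_of_le huu' (h1.trans (hSr r' hrS'))
    obtain ⟨R, hR, hRS⟩ := h2
    refine absurd ⟨R, hR, fun q hq => ?_⟩ (hno v huv)
    rcases le_or_gt r q with h | h
    · exact Or.inr fun p hp hqp => (hSb p hp (h.trans hqp)).of_dist_le (huv.trans (h.trans hqp))
    · refine (hRS q (hSS' ⟨hq, h.le⟩)).imp_right fun hb p hp hqp => ?_
      rcases le_or_gt p r with hpr | hpr
      · exact hb p (hSS' ⟨hp, hpr⟩) hqp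
      · exact (hSb p hp hpr.le).of_dist_le (huv.trans hpr.le)

/-- For every covering by two sets, one of them contains a copy of a given closed ball inside this
ball. -/
lemma AmplyBranching.exists_isometry_closedBall [Countable N] (hN : AmplyBranching N)
    (hC : ∀ v, ∃ i, v ∈ C i) {u : N} {s : ℝ} (hs : s ∈ pointDistSpec u) :
    ∃ (i : Bool) (f : Metric.closedBall u s → N), Isometry f ∧
      ∀ x, f x ∈ C i ∧ f x ∈ Metric.closedBall u s := by
  have hs0 := nonneg_of_mem_pointDistSpec hs
  obtain ⟨i, v, S, h1, h2, h3⟩ : ∃ i v S, dist u v ≤ s ∧ s ∈ S ∧ Sustains (C i) v S := by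
    by_contra! H
    exact hN.not_isBadRadius hC u s ⟨hs, H⟩
  obtain ⟨v', S', h4, h5, h6⟩ := h3.exists_superset h2 hs0 u
  let o : Metric.closedBall u s := ⟨u, Metric.mem_closedBall_self hs0⟩
  have hle : ∀ x : Metric.closedBall u s, dist o x ≤ s := fun x => by
    rw [dist_comm]
    exact x.2
  have h0 : IsPartialCopy (Sustains (C i)) {o} (fun _ => v') := by
    refine ⟨fun a ha b hb => ?_, fun a ha => ⟨S', h4, ?_⟩⟩
    · rw [Finset.mem_singleton.1 ha, Finset.mem_singleton.1 hb, dist_self, dist_self]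
    · rw [Finset.mem_singleton.1 ha]
      rintro _ ⟨x, rfl⟩
      exact h6 _ ⟨x, rfl⟩ (hle x)
  obtain ⟨f, hf, hfC, hfo⟩ := h0.exists_isometry isPlan_sustains
    (by rintro x; exact ⟨x, by rintro _ ⟨y, rfl⟩; exact ⟨y, rfl⟩⟩) (Finset.singleton_nonempty o)
  refine ⟨i, f, hf, fun x => ⟨hfC ⟨x, rfl⟩, ?_⟩⟩
  rw [Metric.mem_closedBall']
  refine dist_le_of_le_of_le (dist_le_of_le_of_le h1 h5) (z := f x) ?_
  rw [← hfo o (Finset.mem_singleton_self o), hf.dist_eq]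
  exact hle x

lemma AmplyBranching.metricIndivisible_closedBall [Countable N] (hN : AmplyBranching N) {u : N}
    {s : ℝ} (hs : s ∈ pointDistSpec u) : MetricIndivisible (Metric.closedBall u s) := by
  intro P Q hPQ _
  obtain ⟨i, f, hf, hfC⟩ := hN.exists_isometry_closedBall
    (C := fun i => bif i then Subtype.val '' P else (Subtype.val '' P)ᶜ)
    (fun v => by
      by_cases h : v ∈ Subtype.val '' P
      · exact ⟨true, h⟩
      · exact ⟨false, h⟩) hs
  let g : Metric.closedBall u s → Metric.closedBall u s := fun x => ⟨f x, (hfC x).2⟩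
  have hg : Isometry g := Isometry.of_dist_eq fun x y => hf.dist_eq x y
  cases i with
  | true =>
    refine Or.inl ⟨g, hg, ?_⟩
    rintro _ ⟨x, rfl⟩
    obtain ⟨y, hy, hyx⟩ := (hfC x).1
    have : g x = y := Subtype.ext hyx.symm
    rwa [this]
  | false =>
    refine Or.inr ⟨g, hg, ?_⟩
    rintro _ ⟨x, rfl⟩
    have : g x ∉ P := fun h => (hfC x).1 ⟨g x, h, rfl⟩
    exact (hPQ.ge (Set.mem_univ (g x))).resolve_left this

lemma MetricIndivisible.of_isometryEquiv {X Y : Type*} [MetricSpace X] [MetricSpace Y]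
    (e : X ≃ᵢ Y) (hX : MetricIndivisible X) : MetricIndivisible Y := by
  intro P Q hPQ hd
  refine (hX (e ⁻¹' P) (e ⁻¹' Q) (by rw [← Set.preimage_union, hPQ, Set.preimage_univ])
    (hd.preimage e)).imp ?_ ?_ <;>
  · rintro ⟨f, hf, hfP⟩
    refine ⟨fun y => e (f (e.symm y)), e.isometry.comp (hf.comp e.symm.isometry), ?_⟩
    rintro _ ⟨y, rfl⟩
    exact hfP ⟨_, rfl⟩

lemma AmplyBranching.hereditarilyMetricIndivisible [Countable N] (hN : AmplyBranching N) :
    HereditarilyMetricIndivisible N := by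
  refine ⟨?_, fun B hB => ?_⟩
  · rcases isEmpty_or_nonempty N with h | ⟨⟨u⟩⟩
    · exact fun P Q _ _ => Or.inl ⟨id, isometry_id, by rintro x; exact h.elim x⟩
    obtain ⟨s, hs, hmax⟩ := (hN.wellFoundedOn u).exists_greatest subset_rfl
      ⟨0, zero_mem_pointDistSpec u⟩
    have huniv : ∀ x, x ∈ Metric.closedBall u s := fun x => by
      rw [Metric.mem_closedBall']
      exact hmax _ ⟨x, rfl⟩
    exact (hN.metricIndivisible_closedBall hs).of_isometryEquiv
      ⟨Equiv.subtypeUnivEquiv huniv, fun x y => rfl⟩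
  · obtain ⟨u, s, hs, rfl⟩ := hN.exists_eq_closedBall hB
    exact hN.metricIndivisible_closedBall hs

end Indivisible

/-! ### The space of labels -/

section LabelDist

variable {L : Type*} [AddCommMonoid L]

open Classical in
/-- The largest place where two finitely supported families of labels differ, or zero. -/
noncomputable def labelDist (g h : ℝ →₀ L) : ℝ :=
  (insert 0 (g.neLocus h)).max' (Finset.insert_nonempty _ _)

lemma labelDist_nonneg (g h : ℝ →₀ L) : 0 ≤ labelDist g h :=
  Finset.le_max' _ _ (Finset.mem_insert_self _ _)

open Classical in
lemma le_labelDist {g h : ℝ →₀ L} {r : ℝ} (hr : g r ≠ h r) : r ≤ labelDist g h :=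
  Finset.le_max' _ _ (Finset.mem_insert_of_mem (Finsupp.mem_neLocus.2 hr))

open Classical in
lemma labelDist_le {g h : ℝ →₀ L} {r : ℝ} (hr : 0 ≤ r) (hgh : ∀ s, r < s → g s = h s) :
    labelDist g h ≤ r := by
  refine Finset.max'_le _ _ _ fun s hs => ?_
  rcases Finset.mem_insert.1 hs with rfl | hs
  · exact hr
  · exact not_lt.1 fun h => Finsupp.mem_neLocus.1 hs (hgh s h)

lemma eq_of_labelDist_lt {g h : ℝ →₀ L} {s : ℝ} (hs : labelDist g h < s) : g s = h s := by
  by_contra hne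
  exact hs.not_ge (le_labelDist hne)

open Classical in
lemma labelDist_eq_zero_or_ne (g h : ℝ →₀ L) :
    labelDist g h = 0 ∨ g (labelDist g h) ≠ h (labelDist g h) :=
  (Finset.mem_insert.1 (Finset.max'_mem _ (Finset.insert_nonempty _ _))).imp_right
    Finsupp.mem_neLocus.1

lemma labelDist_triangle_max (g h k : ℝ →₀ L) :
    labelDist g k ≤ max (labelDist g h) (labelDist h k) :=
  labelDist_le (le_max_of_le_left (labelDist_nonneg _ _)) fun _ hs =>
    (eq_of_labelDist_lt ((le_max_left _ _).trans_lt hs)).trans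
      (eq_of_labelDist_lt ((le_max_right _ _).trans_lt hs))

lemma labelDist_comm (g h : ℝ →₀ L) : labelDist g h = labelDist h g :=
  le_antisymm (labelDist_le (labelDist_nonneg _ _) fun _ hs => (eq_of_labelDist_lt hs).symm)
    (labelDist_le (labelDist_nonneg _ _) fun _ hs => (eq_of_labelDist_lt hs).symm)

/-- Keep the labels above `r`, put the label `l` at `r`, and erase all labels below `r`. -/
noncomputable def relabelAt (g : ℝ →₀ L) (r : ℝ) (l : L) : ℝ →₀ L :=
  g.filter (r < ·) + Finsupp.single r l

lemma relabelAt_self (g : ℝ →₀ L) (r : ℝ) (l : L) : relabelAt g r l r = l := by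
  simp [relabelAt]

lemma relabelAt_of_lt (g : ℝ →₀ L) {r s : ℝ} (l : L) (h : r < s) :
    relabelAt g r l s = g s := by
  simp [relabelAt, h, h.ne]

lemma relabelAt_of_gt (g : ℝ →₀ L) {r s : ℝ} (l : L) (h : s < r) :
    relabelAt g r l s = 0 := by
  simp [relabelAt, h.not_gt, h.ne']

end LabelDist

section Labels

variable {M : Type*} [MetricSpace M]

/-- The distances admitted by a family of labels: those from the base point `o`, and below each
place those from the points in the label at this place. -/
def labelSpec (o : M) (g : ℝ →₀ Multiset M) : Set ℝ :=
  pointDistSpec o ∪ {r | ∃ s, r < s ∧ ∃ x ∈ g s, r ∈ pointDistSpec x}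

lemma mem_labelSpec_congr {o : M} {g h : ℝ →₀ Multiset M} {r : ℝ} (hr : r ∈ labelSpec o g)
    (hgh : ∀ s, r < s → g s = h s) : r ∈ labelSpec o h :=
  hr.imp_right fun ⟨s, hs, x, hx⟩ => ⟨s, hs, x, hgh s hs ▸ hx⟩

lemma labelSpec_subset_distSpec (o : M) (g : ℝ →₀ Multiset M) : labelSpec o g ⊆ distSpec M := by
  rintro r (⟨y, hy⟩ | ⟨s, -, x, -, y, hy⟩)
  exacts [⟨o, y, hy⟩, ⟨x, y, hy⟩]

lemma labelSpec_nonneg {o : M} {g : ℝ →₀ Multiset M} {r : ℝ} (hr : r ∈ labelSpec o g) :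
    0 ≤ r := by
  obtain ⟨x, y, rfl⟩ := labelSpec_subset_distSpec o g hr
  exact dist_nonneg

/-- All points whose spectra occur in `labelSpec o g`. -/
noncomputable def labelPoints (o : M) (g : ℝ →₀ Multiset M) : Multiset M :=
  o ::ₘ ∑ s ∈ g.support, g s

lemma exists_mem_labelPoints {o : M} {g : ℝ →₀ Multiset M} {r : ℝ} (hr : r ∈ labelSpec o g) :
    ∃ x ∈ labelPoints o g, r ∈ pointDistSpec x := by
  rcases hr with hr | ⟨s, -, x, hx, hr⟩
  · exact ⟨o, Multiset.mem_cons_self _ _, hr⟩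
  · refine ⟨x, Multiset.mem_cons_of_mem (Multiset.mem_sum.2 ⟨s, ?_, hx⟩), hr⟩
    rw [Finsupp.mem_support_iff]
    rintro h
    simp [h] at hx

/-- Families of labels whose places are positive admitted distances. -/
def LabelSpace (o : M) : Type _ :=
  {g : ℝ →₀ Multiset M // ∀ r, g r ≠ 0 → 0 < r ∧ r ∈ labelSpec o g}

variable {o : M}

noncomputable instance : MetricSpace (LabelSpace o) where
  dist g h := labelDist g.1 h.1
  dist_self g := le_antisymm (labelDist_le le_rfl fun _ _ => rfl) (labelDist_nonneg _ _)
  dist_comm g h := labelDist_comm _ _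
  dist_triangle g h k := (labelDist_triangle_max _ h.1 _).trans
    (max_le_add_of_nonneg (labelDist_nonneg _ _) (labelDist_nonneg _ _))
  eq_of_dist_eq_zero := by
    intro g h hgh
    refine Subtype.ext (Finsupp.ext fun r => ?_)
    rcases le_or_gt r 0 with hr | hr
    · have hzero : ∀ k : LabelSpace o, k.1 r = 0 := fun k => by
        by_contra hk
        exact hr.not_gt (k.2 r hk).1
      rw [hzero, hzero]
    · exact eq_of_labelDist_lt (hgh.trans_lt hr)

lemma LabelSpace.dist_def (g h : LabelSpace o) : dist g h = labelDist g.1 h.1 := rfl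

instance : IsUltrametricDist (LabelSpace o) where
  dist_triangle_max g h k := labelDist_triangle_max g.1 h.1 k.1

instance [Countable M] : Countable (LabelSpace o) := by
  have hM : Countable (distSpec M) := by
    have h : distSpec M = Set.range fun p : M × M => dist p.1 p.2 := by
      ext r
      simp [distSpec]
    rw [h]
    exact (Set.countable_range _).to_subtype
  have : Countable (Multiset M) := Quotient.countable
  -- All places lie in the countable set `distSpec M`, so restricting to it loses nothing.
  refine Function.Injective.countable
    (f := fun g : LabelSpace o => g.1.subtypeDomain (· ∈ distSpec M)) fun g h hgh => ?_
  have hsupp : ∀ k : LabelSpace o, ∀ r ∈ k.1.support, r ∈ distSpec M := fun k r hr =>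
    labelSpec_subset_distSpec _ _ (k.2 r (Finsupp.mem_support_iff.1 hr)).2
  exact Subtype.ext ((Finsupp.subtypeDomain_eq_iff (hsupp g) (hsupp h)).1 hgh)

/-- Changing the label of a point at an admitted distance `r`. -/
noncomputable def LabelSpace.relabel (g : LabelSpace o) {r : ℝ} (hr : r ∈ labelSpec o g.1)
    (hr0 : 0 < r) (l : Multiset M) : LabelSpace o :=
  ⟨relabelAt g.1 r l, fun s hs => by
    have hcongr : ∀ s ≥ r, s ∈ labelSpec o g.1 → s ∈ labelSpec o (relabelAt g.1 r l) :=
      fun s hrs h => mem_labelSpec_congr h fun p hp => (relabelAt_of_lt _ _ (hrs.trans_lt hp)).symm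
    rcases lt_trichotomy s r with h | rfl | h
    · exact absurd (relabelAt_of_gt _ _ h) hs
    · exact ⟨hr0, hcongr s le_rfl hr⟩
    · rw [relabelAt_of_lt _ _ h] at hs
      exact ⟨(g.2 s hs).1, hcongr s h.le (g.2 s hs).2⟩⟩

lemma LabelSpace.exists_branch (g : LabelSpace o) {r : ℝ} (hr : r ∈ labelSpec o g.1)
    (hr0 : 0 < r) (l : Multiset M) (F : Finset (LabelSpace o)) :
    ∃ h : LabelSpace o, dist g h = r ∧ (∀ y ∈ F, r ≤ dist h y) ∧
      ∀ x ∈ l, ∀ q ∈ pointDistSpec x, q < r → q ∈ labelSpec o h.1 := by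
  classical
  -- Padding with copies of `o` gives infinitely many labels containing `l`, hence one unused by `g`
  -- and `F` at `r`.
  have hinj : Function.Injective fun n : ℕ => l + Multiset.replicate n o := fun m n hmn => by
    simpa using congrArg Multiset.card hmn
  obtain ⟨_, ⟨n, rfl⟩, hn⟩ := (Set.infinite_range_of_injective hinj).exists_notMem_finset
    ((insert g F).image fun y => y.1 r)
  have hne : ∀ y ∈ insert g F, l + Multiset.replicate n o ≠ y.1 r := fun y hy h =>
    hn (Finset.mem_image.2 ⟨y, hy, h.symm⟩)
  refine ⟨g.relabel hr hr0 (l + Multiset.replicate n o), le_antisymm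
    (labelDist_le hr0.le fun s hs => (relabelAt_of_lt _ _ hs).symm) (le_labelDist ?_),
    fun y hy => le_labelDist ?_, fun x hx q hq hqr => Or.inr ⟨r, hqr, x, ?_, hq⟩⟩
  · change _ ≠ relabelAt g.1 r _ r
    rw [relabelAt_self]
    exact (hne g (Finset.mem_insert_self _ _)).symm
  · change relabelAt g.1 r _ r ≠ _
    rw [relabelAt_self]
    exact hne y (Finset.mem_insert_of_mem hy)
  · change x ∈ relabelAt g.1 r _ r
    rw [relabelAt_self]
    exact Multiset.mem_add.2 (Or.inl hx)

/-- At a positive distance one of the two labels is nonzero, so its family admits that place;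
admission depends only on labels above, where the families agree. Conversely, relabel at an admitted
distance. -/
lemma LabelSpace.pointDistSpec_eq (g : LabelSpace o) : pointDistSpec g = labelSpec o g.1 := by
  ext r
  refine ⟨?_, fun hr => ?_⟩
  · rintro ⟨h, rfl⟩
    rcases labelDist_eq_zero_or_ne g.1 h.1 with h0 | hne
    · rw [LabelSpace.dist_def, h0]
      exact Or.inl (zero_mem_pointDistSpec o)
    · by_cases hg : g.1 (labelDist g.1 h.1) = 0
      · rw [hg] at hne
        exact mem_labelSpec_congr (h.2 _ hne.symm).2 fun s hs => (eq_of_labelDist_lt hs).symm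
      · exact (g.2 _ hg).2
  · rcases (labelSpec_nonneg hr).eq_or_lt with rfl | hr0
    · exact zero_mem_pointDistSpec g
    · obtain ⟨h, hh, -⟩ := g.exists_branch hr hr0 0 ∅
      exact ⟨h, hh⟩

/-- The largest distance `D` from `o` is the diameter of `M` and belongs to every spectrum, so the
single label `l`, padded, at place `D` admits all that is needed. -/
lemma LabelSpace.exists_subset_pointDistSpec [IsUltrametricDist M]
    (hM : ∀ x : M, (pointDistSpec x).WellFoundedOn (· > ·)) (o : M) (l : Multiset M) :
    ∃ g : LabelSpace o, ∀ x ∈ l, pointDistSpec x ⊆ pointDistSpec g := by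
  obtain ⟨D, hD, hmax⟩ := (hM o).exists_greatest subset_rfl ⟨0, zero_mem_pointDistSpec o⟩
  have hle : ∀ x : M, ∀ q ∈ pointDistSpec x, q ≤ D := by
    rintro x _ ⟨y, rfl⟩
    exact dist_le_of_le_of_le (y := o) (by rw [dist_comm]; exact hmax _ ⟨x, rfl⟩) (hmax _ ⟨y, rfl⟩)
  have hDx : ∀ x : M, D ∈ pointDistSpec x := fun x =>
    mem_pointDistSpec_of_dist_le hD (hmax _ ⟨x, rfl⟩)
  let z : LabelSpace o := ⟨0, fun r hr => absurd rfl hr⟩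
  rcases (nonneg_of_mem_pointDistSpec hD).eq_or_lt with rfl | hD0
  · refine ⟨z, fun x _ q hq => ?_⟩
    rw [(hle x q hq).antisymm (nonneg_of_mem_pointDistSpec hq)]
    exact zero_mem_pointDistSpec z
  · obtain ⟨g, -, -, hg⟩ := z.exists_branch (r := D) (Or.inl hD) hD0 l ∅
    refine ⟨g, fun x hx q hq => ?_⟩
    rw [LabelSpace.pointDistSpec_eq]
    rcases (hle x q hq).eq_or_lt with rfl | h
    · exact Or.inl hD
    · exact hg x hx q hq h

lemma LabelSpace.amplyBranching [IsUltrametricDist M]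
    (hM : ∀ x : M, (pointDistSpec x).WellFoundedOn (· > ·)) (o : M) :
    AmplyBranching (LabelSpace o) where
  exists_branch u w r hr hr0 F := by
    rw [LabelSpace.pointDistSpec_eq] at hr
    obtain ⟨v, h1, h2, h3⟩ := u.exists_branch hr hr0 (labelPoints o w.1) F
    refine ⟨v, h1, h2, fun q hq hqr => ?_⟩
    rw [LabelSpace.pointDistSpec_eq] at hq ⊢
    obtain ⟨x, hx, hqx⟩ := exists_mem_labelPoints hq
    exact h3 x hx q hqx hqr
  wellFoundedOn u := by
    classical
    refine ((labelPoints o u.1).toFinset.wellFoundedOn_bUnion.2 fun x _ => hM x).subset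
      fun r hr => ?_
    rw [LabelSpace.pointDistSpec_eq] at hr
    obtain ⟨x, hx, hrx⟩ := exists_mem_labelPoints hr
    exact Set.mem_iUnion₂.2 ⟨x, Multiset.mem_toFinset.2 hx, hrx⟩
  directed u w := by
    obtain ⟨z, hz⟩ := exists_subset_pointDistSpec hM o (labelPoints o u.1 + labelPoints o w.1)
    refine ⟨z, fun r hr => ?_, fun r hr => ?_⟩ <;>
    · rw [LabelSpace.pointDistSpec_eq] at hr
      obtain ⟨x, hx, hrx⟩ := exists_mem_labelPoints hr
      exact hz x (Multiset.mem_add.2 (by tauto)) hrx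

lemma LabelSpace.distSpec_eq [IsUltrametricDist M]
    (hM : ∀ x : M, (pointDistSpec x).WellFoundedOn (· > ·)) (o : M) :
    distSpec (LabelSpace o) = distSpec M := by
  ext r
  constructor
  · rintro ⟨g, h, rfl⟩
    have hd : dist g h ∈ pointDistSpec g := ⟨h, rfl⟩
    rw [LabelSpace.pointDistSpec_eq] at hd
    exact labelSpec_subset_distSpec _ _ hd
  · rintro ⟨x, y, rfl⟩
    obtain ⟨g, hg⟩ := exists_subset_pointDistSpec hM o {x}
    obtain ⟨h, hh⟩ := hg x (Multiset.mem_singleton_self x) ⟨y, rfl⟩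
    exact ⟨g, h, hh⟩

end Labels

/-! ### Increasing balls, and the theorem -/

lemma wellFoundedOn_pointDistSpec {M : Type*} [MetricSpace M] (h : ¬ HasIncreasingBalls M) (a : M) :
    (pointDistSpec a).WellFoundedOn (· > ·) := by
  rw [Set.wellFoundedOn_iff_no_descending_seq]
  intro s hs
  have hlt : ∀ n, s n < s (n + 1) := fun n => s.map_rel_iff.2 (Nat.lt_succ_self n)
  refine h ⟨fun n => Metric.closedBall a (s n), fun n =>
    ⟨a, s n, Or.inr ⟨nonneg_of_mem_pointDistSpec (hs n), rfl⟩⟩, fun n => ?_⟩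
  refine ⟨Metric.closedBall_subset_closedBall (hlt n).le, fun hsub => ?_⟩
  obtain ⟨x, hx⟩ := hs (n + 1)
  have hx' := hsub (Metric.mem_closedBall'.2 hx.le)
  rw [Metric.mem_closedBall', hx] at hx'
  exact hx'.not_gt (hlt n)

lemma IsBallSet.mem_of_dist_le {M : Type*} [MetricSpace M] [IsUltrametricDist M] {B : Set M}
    (hB : IsBallSet B) {a x y : M} (ha : a ∈ B) (hx : x ∈ B) (h : dist a y ≤ dist a x) :
    y ∈ B := by
  obtain ⟨c, r, ⟨-, rfl⟩ | ⟨-, rfl⟩⟩ := hB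
  · rw [Metric.mem_ball'] at *
    have hax : dist a x < r := (dist_triangle_max a c x).trans_lt (max_lt (by rwa [dist_comm]) hx)
    exact (dist_triangle_max c a y).trans_lt (max_lt ha (h.trans_lt hax))
  · rw [Metric.mem_closedBall'] at *
    exact dist_le_of_le_of_le ha (h.trans (dist_le_of_le_of_le (by rwa [dist_comm]) hx))

lemma HasIncreasingBalls.exists_strictMono {M : Type*} [MetricSpace M] [IsUltrametricDist M]
    (h : HasIncreasingBalls M) :
    ∃ (a : M) (x : ℕ → M), StrictMono fun n => dist a (x n) := by
  obtain ⟨B, hB, hlt⟩ := h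
  choose x hx hxn using fun n => Set.exists_of_ssubset (hlt n)
  -- Here `x n` lies in `B (n + 1)` but not in `B n`; if `x (n + 2)` were no farther from `x 0` than
  -- `x (n + 1)`, it would lie in `B (n + 2)`.
  refine ⟨x 0, fun n => x (n + 1), strictMono_nat_of_lt_succ fun n => not_le.1 fun hle => ?_⟩
  have hmono : Monotone B := monotone_nat_of_le_succ fun n => (hlt n).subset
  exact hxn (n + 2) ((hB (n + 2)).mem_of_dist_le (hmono (by omega : 1 ≤ n + 2) (hx 0))
    (hx (n + 1)) hle)

/-- An indivisible ultrametric space contains no sequence of points at strictly increasing distances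
from a given point. -/
lemma MetricIndivisible.not_strictMono {N : Type*} [MetricSpace N] [IsUltrametricDist N]
    (hN : MetricIndivisible N) (a : N) (x : ℕ → N) : ¬ StrictMono fun n => dist a (x n) := by
  classical
  intro hmono
  let s : ℕ → ℝ := fun n => dist a (x n)
  let near : Setoid N :=
    { r := fun y z => ∃ n, dist y z < s n
      iseqv :=
        -- Index `1`, because `s 0` may be zero.
        { refl := fun y => ⟨1, by
            rw [dist_self]
            exact dist_nonneg.trans_lt (hmono Nat.zero_lt_one)⟩
          symm := fun ⟨n, hn⟩ => ⟨n, by rwa [dist_comm]⟩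
          trans := by
            rintro y z w ⟨m, hm⟩ ⟨n, hn⟩
            exact ⟨max m n, (dist_triangle_max y z w).trans_lt (max_lt
              (hm.trans_le (hmono.monotone (le_max_left m n)))
              (hn.trans_le (hmono.monotone (le_max_right m n))))⟩ } }
  let c : N → N := fun y => (Quotient.mk near y).out
  have hc : ∀ y, ∃ n, dist (c y) y < s n := fun y =>
    Quotient.exact (Quotient.out_eq (Quotient.mk near y))
  let level : N → ℕ := fun y => Nat.find (hc y)
  -- The representative `c (f a)` lies within some `s m` of `f a`; for `n ≥ m` it is therefore at
  -- distance exactly `s n` from `f (x n)`, and the first scale strictly above that is `n + 1`.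
  have key : ∀ f : N → N, Isometry f → ∃ m, ∀ n ≥ m, level (f (x n)) = n + 1 := by
    intro f hf
    obtain ⟨m, hm⟩ := hc (f a)
    refine ⟨m, fun n hn => ?_⟩
    have hmn : dist (c (f a)) (f a) < s n := hm.trans_le (hmono.monotone hn)
    have hd : dist (f a) (f (x n)) = s n := hf.dist_eq _ _
    have hcc : c (f (x n)) = c (f a) :=
      congrArg Quotient.out (Quotient.sound (s := near)
        ⟨n + 1, by rw [dist_comm, hd]; exact hmono n.lt_succ_self⟩)
    have hcd : dist (c (f (x n))) (f (x n)) = s n := by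
      rw [hcc]
      exact le_antisymm (dist_le_of_le_of_le hmn.le hd.le)
        (le_dist_of_dist_lt (x := f a) (by rwa [dist_comm]) hd.ge)
    refine (Nat.find_eq_iff _).2 ⟨?_, fun k hk => ?_⟩
    · rw [hcd]
      exact hmono n.lt_succ_self
    · rw [hcd, not_lt]
      exact hmono.monotone (Nat.lt_succ_iff.1 hk)
  rcases hN {y | Even (level y)} {y | Even (level y)}ᶜ (Set.union_compl_self _)
    disjoint_compl_right with ⟨f, hf, hfP⟩ | ⟨f, hf, hfP⟩ <;>
  obtain ⟨m, hm⟩ := key f hf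
  · have h1 : Even (level (f (x (2 * m)))) := hfP ⟨_, rfl⟩
    rw [hm _ (by omega)] at h1
    exact absurd h1 (by simp)
  · have h1 : ¬ Even (level (f (x (2 * m + 1)))) := hfP ⟨_, rfl⟩
    rw [hm _ (by omega)] at h1
    exact h1 ⟨m + 1, by ring⟩

lemma not_hasIncreasingBalls_of_isometry {M N : Type*} [MetricSpace M] [IsUltrametricDist M]
    [MetricSpace N] [IsUltrametricDist N] (hN : MetricIndivisible N) {f : M → N}
    (hf : Isometry f) : ¬ HasIncreasingBalls M := by
  intro h
  obtain ⟨a, x, hx⟩ := h.exists_strictMono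
  refine hN.not_strictMono (f a) (f ∘ x) ?_
  simpa only [Function.comp_apply, hf.dist_eq] using hx

lemma exists_specEndogeneous_hereditarilyMetricIndivisible (M : Type u) [MetricSpace M]
    [IsUltrametricDist M] [Countable M] (h : ¬ HasIncreasingBalls M) :
    ∃ (N : Type u) (_ : MetricSpace N) (_ : IsUltrametricDist N) (_ : Countable N),
      SpecEndogeneous N ∧ HereditarilyMetricIndivisible N ∧ distSpec N = distSpec M ∧
        ∃ f : M → N, Isometry f := by
  rcases isEmpty_or_nonempty M with hM | ⟨⟨o⟩⟩
  · have hamp : AmplyBranching M := ⟨fun u => hM.elim u, fun u => hM.elim u, fun u => hM.elim u⟩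
    exact ⟨M, inferInstance, inferInstance, inferInstance, hamp.specEndogeneous,
      hamp.hereditarilyMetricIndivisible, rfl, id, isometry_id⟩
  · have hwf := wellFoundedOn_pointDistSpec h
    have hamp := LabelSpace.amplyBranching hwf o
    have : Nonempty M := ⟨o⟩
    refine ⟨LabelSpace o, inferInstance, inferInstance, inferInstance, hamp.specEndogeneous,
      hamp.hereditarilyMetricIndivisible, LabelSpace.distSpec_eq hwf o,
      hamp.exists_isometry fun x => ?_⟩
    obtain ⟨g, hg⟩ := LabelSpace.exists_subset_pointDistSpec hwf o {x}
    exact ⟨g, hg x (Multiset.mem_singleton_self x)⟩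

theorem theorem7 (M : Type u) [MetricSpace M] [IsUltrametricDist M] [Countable M] :
    ((∃ (N : Type u) (_ : MetricSpace N) (_ : IsUltrametricDist N) (_ : Countable N),
        MetricIndivisible N ∧ ∃ f : M → N, Isometry f) ↔ ¬ HasIncreasingBalls M) ∧
    (¬ HasIncreasingBalls M →
      ∃ (N : Type u) (_ : MetricSpace N) (_ : IsUltrametricDist N) (_ : Countable N),
        SpecEndogeneous N ∧ HereditarilyMetricIndivisible N ∧ distSpec N = distSpec M ∧
          ∃ f : M → N, Isometry f) := by
  refine ⟨⟨?_, fun h => ?_⟩, exists_specEndogeneous_hereditarilyMetricIndivisible M⟩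
  · rintro ⟨N, _, _, _, hN, f, hf⟩
    exact not_hasIncreasingBalls_of_isometry hN hf
  · obtain ⟨N, _, _, _, -, hN, -, hf⟩ := exists_specEndogeneous_hereditarilyMetricIndivisible M h
    exact ⟨N, _, ‹_›, ‹_›, hN.1, hf⟩
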